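/- Let a polyhedron be given by a linear system as $P=\{x\in\mathbb R^N : Ax=b,\ Bx\le d\}$. A vector $g\in\mathbb Z^N$ is a circuit of the system if $g\neq 0$, $Ag=0$, the components of $g$ are coprime, and the support of $Bg$ is inclusion-minimal among the supports of the vectors $Bx$ with $x\neq 0$, $Ax=0$. A circuit walk in $P$ is a sequence $y^{(0)},\dots,y^{(k)}$ of points of $P$, where $y^{(0)}$ and $y^{(k)}$ are vertices, such that for each $i<k$ one has $y^{(i+1)}=y^{(i)}+\alpha_i g^{(i)}$ for some circuit $g^{(i)}$ and some $\alpha_i>0$, and $y^{(i)}+\alpha g^{(i)}\notin P$ for all $\alpha>\alpha_i$. It is integral if all $y^{(i)}$ have integer coordinates, a vertex walk if all $y^{(i)}$ are vertices of $P$, and an edge walk if, for each $i<k$, the points $y^{(i)}$ and $y^{(i+1)}$ are the two end vertices of an edge (one-dimensional face) of $P$. Call $P$ (with the given system) GCW if it is integral, i.e. all its vertices have integer coordinates; ICW (resp. VCW, ECW) if it is integral and all its circuit walks are integral (resp. vertex walks, edge walks). a) There is a matroid $M$ on a finite ground set $E$, with rank function $f$, whose matroid polytope, i.e. the convex hull of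 the incidence vectors of the independent sets of $M$, is given by the system $x\ge 0$, $\sum_{e\in S}x_e\le f(S)$ for all $S\subseteq E$, and with this system is GCW but not ICW. b) There are $m,n$ and positive integers $u_1,\dots,u_m$, $v_1,\dots,v_n$ such that the transportation polytope given by $\sum_{j}y_{ij}=u_i$ for all $i\le m$, $\sum_i y_{ij}=v_j$ for all $j\le n$, and $y_{ij}\ge 0$ for all $i,j$, is ICW but not VCW. c) There are $k,n$ and positive integers $\kappa_i^-\le\kappa_i^+$ for $i\le k$ such that the bounded-size partition polytope given by $\sum_{i}y_{ij}=1$ for all $j\le n$, $\sum_j y_{ij}\ge\kappa_i^-$ and $\sum_j y_{ij}\le\kappa_i^+$ for all $i\le k$, and $y_{ij}\ge0$ for all $i,j$, is VCW but not ECW. d) For all $k,n$ and all nonnegative integers $\kappa_1,\dots,\kappa_k$, the fixed-size partition polytope given by $\sum_j y_{ij}=\kappa_i$ for all $i\le k$, $\sum_i y_{ij}=1$ for all $j\le n$, and $y_{ij}\ge 0$ for all $i,j$, is ECW. -/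

import Mathlib

/-- A linear system `A x = b`, `B x ≤ d` in the variables `x : ι → ℝ`, that is, a polyhedron
together with a chosen description by equations (indexed by `p`) and inequalities
(indexed by `q`). -/
structure LinSystem (p q ι : Type) where
  A : Matrix p ι ℝ
  b : p → ℝ
  B : Matrix q ι ℝ
  d : q → ℝ

/-- All coordinates of `x` are integers. -/
def IsIntegerVec {ι : Type} (x : ι → ℝ) : Prop := ∀ e, ∃ z : ℤ, x e = (z : ℝ)

namespace LinSystem

variable {p q ι : Type} [Fintype ι]

/-- The polyhedron `{x | A x = b, B x ≤ d}`. -/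
def polyhedron (P : LinSystem p q ι) : Set (ι → ℝ) :=
  {x | P.A.mulVec x = P.b ∧ P.B.mulVec x ≤ P.d}

/-- `x` is a vertex of the polyhedron. -/
def IsVertex (P : LinSystem p q ι) (x : ι → ℝ) : Prop :=
  x ∈ Set.extremePoints ℝ P.polyhedron

/-- The segment between the two distinct points `x` and `y` is an edge (a one-dimensional bounded
face) of the polyhedron, with end vertices `x` and `y`. Faces are the sets of maximizers of
linear functionals. -/
def IsEdge (P : LinSystem p q ι) (x y : ι → ℝ) : Prop :=
  P.IsVertex x ∧ P.IsVertex y ∧ x ≠ y ∧ IsExposed ℝ P.polyhedron (segment ℝ x y)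

/-- `g` is a circuit of the system: a nonzero vector of `ker A` with coprime integer components
such that the support of `B g` is inclusion-minimal among the supports of the vectors `B x` with
`x ∈ ker A`, `x ≠ 0`. -/
def IsCircuit (P : LinSystem p q ι) (g : ι → ℝ) : Prop :=
  (∃ z : ι → ℤ, (∀ e, g e = (z e : ℝ)) ∧ Finset.univ.gcd z = 1) ∧
  P.A.mulVec g = 0 ∧ g ≠ 0 ∧
  ∀ x : ι → ℝ, P.A.mulVec x = 0 → x ≠ 0 →
    Function.support (P.B.mulVec x) ⊆ Function.support (P.B.mulVec g) →
    Function.support (P.B.mulVec x) = Function.support (P.B.mulVec g)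

/-- `y 0, …, y k` is a circuit walk: it leads from a vertex to a vertex through points of the
polyhedron, and each step is a step of maximal positive length along a circuit. -/
def IsCircuitWalk (P : LinSystem p q ι) {k : ℕ} (y : Fin (k + 1) → ι → ℝ) : Prop :=
  P.IsVertex (y 0) ∧ P.IsVertex (y (Fin.last k)) ∧
  ∀ i : Fin k, y i.castSucc ∈ P.polyhedron ∧
    ∃ (g : ι → ℝ) (a : ℝ), P.IsCircuit g ∧ 0 < a ∧
      y i.succ = y i.castSucc + a • g ∧
      ∀ a' : ℝ, a < a' → y i.castSucc + a' • g ∉ P.polyhedron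

/-- A GCW polyhedron (the most general level of the hierarchy) is an integral polyhedron:
all its vertices have integer coordinates. -/
def IsGCW (P : LinSystem p q ι) : Prop := ∀ x, P.IsVertex x → IsIntegerVec x

/-- An ICW polyhedron: integral, and all circuit walks are integral. -/
def IsICW (P : LinSystem p q ι) : Prop :=
  P.IsGCW ∧ ∀ (k : ℕ) (y : Fin (k + 1) → ι → ℝ), P.IsCircuitWalk y → ∀ i, IsIntegerVec (y i)

/-- A VCW polyhedron: integral, and all circuit walks are vertex walks. -/
def IsVCW (P : LinSystem p q ι) : Prop :=
  P.IsGCW ∧ ∀ (k : ℕ) (y : Fin (k + 1) → ι → ℝ), P.IsCircuitWalk y → ∀ i, P.IsVertex (y i)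

/-- An ECW polyhedron: integral, and all circuit walks are edge walks. -/
def IsECW (P : LinSystem p q ι) : Prop :=
  P.IsGCW ∧ ∀ (k : ℕ) (y : Fin (k + 1) → ι → ℝ), P.IsCircuitWalk y →
    ∀ i : Fin k, P.IsEdge (y i.castSucc) (y i.succ)

end LinSystem

/-- The matroid polytope of a matroid with ground set `Fin n`: the convex hull of the incidence
vectors of its independent sets. -/
noncomputable def matroidPolytope {n : ℕ} (M : Matroid (Fin n)) : Set (Fin n → ℝ) :=
  convexHull ℝ {x | ∃ I : Set (Fin n), M.Indep I ∧ x = I.indicator 1}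

/-- The system `x_e ≥ 0` for all `e`, `∑_{e ∈ S} x_e ≤ f S` for all subsets `S` of the ground set,
where `f` is the rank function of `M` (there are no equations). -/
noncomputable def matroidSystem {n : ℕ} (M : Matroid (Fin n)) :
    LinSystem Empty (Fin n ⊕ Finset (Fin n)) (Fin n) where
  A := 0
  b := 0
  B := Matrix.of (Sum.elim (fun e e' => if e' = e then -1 else 0)
    (fun S e' => if e' ∈ S then 1 else 0))
  d := Sum.elim (fun _ => 0) (fun S => ((M.eRk (S : Set (Fin n))).toNat : ℝ))

/-- The transportation polytope with supplies `u` and demands `v`: `∑ j, y (i, j) = u i`,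
`∑ i, y (i, j) = v j`, `y (i, j) ≥ 0`. -/
def transportationSystem {m n : ℕ} (u : Fin m → ℕ) (v : Fin n → ℕ) :
    LinSystem (Fin m ⊕ Fin n) (Fin m × Fin n) (Fin m × Fin n) where
  A := Matrix.of (Sum.elim (fun i c => if c.1 = i then 1 else 0)
    (fun j c => if c.2 = j then 1 else 0))
  b := Sum.elim (fun i => (u i : ℝ)) (fun j => (v j : ℝ))
  B := Matrix.of (fun c c' => if c' = c then -1 else 0)
  d := 0

/-- The bounded-size partition polytope of `n` items and `k` clusters with size bounds
`l i ≤ |C i| ≤ u i`: `∑ i, y (i, j) = 1`, `∑ j, y (i, j) ≥ l i`, `∑ j, y (i, j) ≤ u i`,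
`y (i, j) ≥ 0`. -/
def boundedSizePartitionSystem {k : ℕ} (n : ℕ) (l u : Fin k → ℕ) :
    LinSystem (Fin n) (Fin k ⊕ Fin k ⊕ Fin k × Fin n) (Fin k × Fin n) where
  A := Matrix.of (fun j c => if c.2 = j then 1 else 0)
  b := fun _ => 1
  B := Matrix.of (Sum.elim (fun i c => if c.1 = i then -1 else 0)
    (Sum.elim (fun i c => if c.1 = i then 1 else 0)
      (fun c c' => if c' = c then -1 else 0)))
  d := Sum.elim (fun i => -(l i : ℝ)) (Sum.elim (fun i => (u i : ℝ)) (fun _ => 0))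

/-- The fixed-size partition polytope of `n` items and `k` clusters with sizes `|C i| = κ i`:
`∑ j, y (i, j) = κ i`, `∑ i, y (i, j) = 1`, `y (i, j) ≥ 0`. -/
def fixedSizePartitionSystem {k : ℕ} (n : ℕ) (κ : Fin k → ℕ) :
    LinSystem (Fin k ⊕ Fin n) (Fin k × Fin n) (Fin k × Fin n) :=
  transportationSystem κ (fun _ : Fin n => 1)

/-! A point is a vertex exactly when no nonzero direction in `ker A` is annihilated by all tight
rows (`isVertex_of_tight`, `IsVertex.eq_zero_of_tight`). When `B` is injective, a circuit is
parallel to every nonzero `h` in `ker A` with the support of `B h` inside its own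
(`IsCircuit.eq_smul`). If `B h` moreover has entries in {-1, 0, 1}, maximal steps between such
directions preserve integrality (`isIntegerVec_step`).

a) A coloop with a parallel pair gives a segment times a triangle; the circuit (-1, 1, 1) leads from
(1, 0, 0) to the point with all coordinates 1/2, and (1, 1, -1) leads on to a vertex.

b) With two rows, circuits exchange between two columns, so walks are integral. An exchange may stop
at an integral point with two entirely positive columns, which is not a vertex.

c) With two clusters, circuits swap two items or move one, so walks are integral, and integral
points of a partition polytope are vertices. A swap can be the diagonal of a square face when the
size bounds are slack.

d) At a vertex each column holds a single 1. The feasible points vanishing wherever both the vertex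
and the circuit vanish then lie on the line of the circuit, so the step traverses an edge
(`isEdge_of_face`). -/

namespace LinSystem

/-! ### Vertices, circuits and maximal steps of general systems -/

variable {p q ι : Type} [Fintype ι]

/-- A row tight at a proper convex combination is tight at both points, so their difference is
annihilated by all tight rows. -/
theorem isVertex_of_tight {P : LinSystem p q ι} {x : ι → ℝ} (hx : x ∈ P.polyhedron)
    (h : ∀ h : ι → ℝ, P.A.mulVec h = 0 →
      (∀ i, P.B.mulVec x i = P.d i → P.B.mulVec h i = 0) → h = 0) : P.IsVertex x := by
  refine ⟨hx, ?_⟩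
  rintro x₁ ⟨hA₁, hB₁⟩ x₂ ⟨hA₂, hB₂⟩ ⟨α, β, hα, hβ, hαβ, rfl⟩
  have key : x₁ - x₂ = 0 := by
    refine h _ (by rw [Matrix.mulVec_sub, hA₁, hA₂, sub_self]) fun i hi => ?_
    have h₁ := hB₁ i
    have h₂ := hB₂ i
    simp only [Matrix.mulVec_add, Matrix.mulVec_smul, Matrix.mulVec_sub, Pi.add_apply,
      Pi.smul_apply, Pi.sub_apply, smul_eq_mul] at hi ⊢
    have hβ' : β = 1 - α := by linarith
    subst hβ'
    have e₁ : α * (P.d i - P.B.mulVec x₁ i) = 0 := by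
      nlinarith [mul_nonneg hα.le (sub_nonneg.2 h₁), mul_nonneg hβ.le (sub_nonneg.2 h₂)]
    have e₂ : (1 - α) * (P.d i - P.B.mulVec x₂ i) = 0 := by
      nlinarith [mul_nonneg hα.le (sub_nonneg.2 h₁), mul_nonneg hβ.le (sub_nonneg.2 h₂)]
    have f₁ := (mul_eq_zero.1 e₁).resolve_left hα.ne'
    have f₂ := (mul_eq_zero.1 e₂).resolve_left hβ.ne'
    linarith
  rw [sub_eq_zero] at key
  subst key
  rw [← add_smul, hαβ, one_smul]

/-- The finitely many slack rows stay satisfied under small moves, so `x` would be the midpoint of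
`x ± ε • h`. -/
theorem IsVertex.eq_zero_of_tight [Finite q] {P : LinSystem p q ι} {x h : ι → ℝ}
    (hx : P.IsVertex x) (hA : P.A.mulVec h = 0)
    (hB : ∀ i, P.B.mulVec x i = P.d i → P.B.mulVec h i = 0) : h = 0 := by
  obtain ⟨⟨hxA, hxB⟩, hext⟩ := hx
  have hev : ∀ᶠ ε : ℝ in nhdsWithin 0 (Set.Ioi 0), 0 < ε ∧ ∀ i,
      P.B.mulVec x i + ε * P.B.mulVec h i ≤ P.d i ∧
      P.B.mulVec x i - ε * P.B.mulVec h i ≤ P.d i := by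
    refine (eventually_mem_nhdsWithin).and (Filter.eventually_all.2 fun i => ?_)
    rcases (hxB i).eq_or_lt with hi | hi
    · simp [hB i hi, hi]
    · have c₁ : Filter.Tendsto (fun ε : ℝ => P.B.mulVec x i + ε * P.B.mulVec h i)
          (nhds 0) (nhds (P.B.mulVec x i)) := by
        have : Continuous (fun ε : ℝ => P.B.mulVec x i + ε * P.B.mulVec h i) := by fun_prop
        simpa using this.tendsto 0
      have c₂ : Filter.Tendsto (fun ε : ℝ => P.B.mulVec x i - ε * P.B.mulVec h i)
          (nhds 0) (nhds (P.B.mulVec x i)) := by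
        have : Continuous (fun ε : ℝ => P.B.mulVec x i - ε * P.B.mulVec h i) := by fun_prop
        simpa using this.tendsto 0
      filter_upwards [nhdsWithin_le_nhds (c₁.eventually_lt_const hi),
        nhdsWithin_le_nhds (c₂.eventually_lt_const hi)] with ε h₁ h₂ using ⟨h₁.le, h₂.le⟩
  obtain ⟨ε, hε, hεB⟩ := hev.exists
  have m₁ : x + ε • h ∈ P.polyhedron := by
    refine ⟨by rw [Matrix.mulVec_add, Matrix.mulVec_smul, hA, hxA, smul_zero, add_zero],
      fun i => ?_⟩
    simpa [Matrix.mulVec_add, Matrix.mulVec_smul] using (hεB i).1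
  have m₂ : x - ε • h ∈ P.polyhedron := by
    refine ⟨by rw [Matrix.mulVec_sub, Matrix.mulVec_smul, hA, hxA, smul_zero, sub_zero],
      fun i => ?_⟩
    simpa [Matrix.mulVec_sub, Matrix.mulVec_smul] using (hεB i).2
  have := hext m₁ m₂ ⟨1 / 2, 1 / 2, by norm_num, by norm_num, by norm_num, by
    ext e; simp; ring⟩
  have h0 : ε • h = 0 := by simpa using this
  exact (smul_eq_zero.1 h0).resolve_left hε.ne'

/-- Subtracting the multiple of `h` that cancels one entry of `B g` strictly shrinks the support, so
by minimality the difference is zero. -/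
theorem IsCircuit.eq_smul {P : LinSystem p q ι} {g h : ι → ℝ} (hg : P.IsCircuit g)
    (hinj : ∀ x, P.B.mulVec x = 0 → x = 0) (hA : P.A.mulVec h = 0) (h0 : h ≠ 0)
    (hsupp : ∀ i, P.B.mulVec g i = 0 → P.B.mulVec h i = 0) : ∃ c : ℝ, g = c • h := by
  obtain ⟨-, hgA, -, hmin⟩ := hg
  obtain ⟨i, hi⟩ : ∃ i, P.B.mulVec h i ≠ 0 := by
    by_contra! hcon
    exact h0 (hinj h (funext hcon))
  refine ⟨P.B.mulVec g i / P.B.mulVec h i, ?_⟩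
  set c := P.B.mulVec g i / P.B.mulVec h i with hc
  by_contra hne
  have hBx : ∀ j, P.B.mulVec (g - c • h) j = P.B.mulVec g j - c * P.B.mulVec h j := fun j => by
    simp [Matrix.mulVec_sub, Matrix.mulVec_smul]
  have hs := hmin (g - c • h) (by
    rw [Matrix.mulVec_sub, Matrix.mulVec_smul, hgA, hA, smul_zero, sub_zero])
    (sub_ne_zero.2 hne) (by
      intro j hj hgj
      refine hj ?_
      rw [hBx, hgj, hsupp j hgj]; simp)
  have hig : i ∈ Function.support (P.B.mulVec g) := fun hcon => hi (hsupp i hcon)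
  rw [← hs] at hig
  refine hig ?_
  rw [hBx, hc, div_mul_cancel₀ _ hi, sub_self]

theorem isCircuit_of_forall {P : LinSystem p q ι} {g : ι → ℝ} (z : ι → ℤ)
    (hz : ∀ e, g e = z e) (hgcd : Finset.univ.gcd z = 1) (hA : P.A.mulVec g = 0) (h0 : g ≠ 0)
    (hmin : ∀ x, P.A.mulVec x = 0 → (∀ i, P.B.mulVec g i = 0 → P.B.mulVec x i = 0) →
      ∃ c : ℝ, x = c • g) : P.IsCircuit g := by
  refine ⟨⟨z, hz, hgcd⟩, hA, h0, fun x hxA hx0 hsupp => ?_⟩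
  obtain ⟨c, rfl⟩ := hmin x hxA fun i hi => by
    by_contra hcon
    exact hsupp hcon hi
  have hc : c ≠ 0 := by rintro rfl; simp at hx0
  ext i
  simp [Matrix.mulVec_smul, hc]

theorem IsCircuitWalk.mem {P : LinSystem p q ι} {k : ℕ} {y : Fin (k + 1) → ι → ℝ}
    (hy : P.IsCircuitWalk y) (i : Fin (k + 1)) : y i ∈ P.polyhedron := by
  induction i using Fin.lastCases with
  | last => exact hy.2.1.1
  | cast i => exact (hy.2.2 i).1

/-- A property of the vertices that maximal circuit steps preserve holds along circuit walks. -/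
theorem IsCircuitWalk.induction {P : LinSystem p q ι} {k : ℕ} {y : Fin (k + 1) → ι → ℝ}
    (hy : P.IsCircuitWalk y) {motive : (ι → ℝ) → Prop} (h0 : ∀ x, P.IsVertex x → motive x)
    (hstep : ∀ (x g : ι → ℝ) (a : ℝ), motive x → x ∈ P.polyhedron → P.IsCircuit g → 0 < a →
      x + a • g ∈ P.polyhedron → (∀ a', a < a' → x + a' • g ∉ P.polyhedron) →
      motive (x + a • g)) (i : Fin (k + 1)) : motive (y i) := by
  induction i using Fin.induction with
  | zero => exact h0 _ hy.1
  | succ i ih =>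
    obtain ⟨hmem, g, a, hg, ha, hi, hmax⟩ := hy.2.2 i
    have := hy.mem i.succ
    rw [hi] at this ⊢
    exact hstep _ g a ih hmem hg ha this hmax

/-- A maximal step from an integral point along a multiple of a vector `h` with `B h` in
`{-1, 0, 1}` is integral. -/
theorem isIntegerVec_step {P : LinSystem p q ι} {y g h : ι → ℝ} {a c : ℝ}
    (hd : ∀ i, ∃ z : ℤ, P.d i = z) (hBy : ∀ i, ∃ z : ℤ, P.B.mulVec y i = z)
    (hy : IsIntegerVec y) (hh : IsIntegerVec h) (hA : P.A.mulVec h = 0)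
    (hB : ∀ i, P.B.mulVec h i = -1 ∨ P.B.mulVec h i = 0 ∨ P.B.mulVec h i = 1)
    (hyP : y ∈ P.polyhedron) (hg0 : g ≠ 0) (hg : g = c • h) (ha : 0 < a)
    (hmem : y + a • g ∈ P.polyhedron) (hmax : ∀ a', a < a' → y + a' • g ∉ P.polyhedron) :
    IsIntegerVec (y + a • g) := by
  wlog hc : 0 < c generalizing c h
  · refine this (h := -h) (c := -c) (fun e => ?_) (by rw [Matrix.mulVec_neg, hA, neg_zero])
      (fun i => ?_) (by simpa using hg) ?_
    · obtain ⟨z, hz⟩ := hh e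
      exact ⟨-z, by simp [hz]⟩
    · rw [Matrix.mulVec_neg, Pi.neg_apply]
      rcases hB i with h | h | h <;> simp [h]
    · have : c ≠ 0 := by rintro rfl; simp at hg; exact hg0 hg
      rcases lt_or_gt_of_ne this with h | h
      · linarith
      · exact absurd h hc
  subst hg
  -- Rounding the step length up stays feasible: only rows with entry 1 tighten, and their slack is
  -- an integer that is at least `a * c`. Maximality then forces `a * c` to be an integer.
  have hceil : y + (⌈a * c⌉ : ℝ) • h ∈ P.polyhedron := by
    refine ⟨by rw [Matrix.mulVec_add, Matrix.mulVec_smul, hA, hyP.1, smul_zero, add_zero],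
      fun i => ?_⟩
    have h1 := hyP.2 i
    have h2 := hmem.2 i
    have hpos : (0 : ℝ) ≤ ⌈a * c⌉ := by exact_mod_cast Int.ceil_nonneg (mul_pos ha hc).le
    simp only [Matrix.mulVec_add, Matrix.mulVec_smul, Pi.add_apply, Pi.smul_apply,
      smul_eq_mul] at h2 ⊢
    rcases hB i with h | h | h
    · rw [h]; linarith
    · rw [h]; linarith
    · obtain ⟨z, hz⟩ := hd i
      obtain ⟨w, hw⟩ := hBy i
      rw [h, hz, hw] at h2 ⊢
      have : a * c ≤ ((z - w : ℤ) : ℝ) := by push_cast; linarith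
      have : (⌈a * c⌉ : ℝ) ≤ ((z - w : ℤ) : ℝ) := by exact_mod_cast Int.ceil_le.2 this
      push_cast at this
      linarith
  have hle : (⌈a * c⌉ : ℝ) ≤ a * c := by
    by_contra! hlt
    refine hmax (⌈a * c⌉ / c) ((lt_div_iff₀ hc).2 hlt) ?_
    rwa [smul_smul, div_mul_cancel₀ _ hc.ne']
  have heq : a * c = (⌈a * c⌉ : ℝ) := le_antisymm (Int.le_ceil _) hle
  intro e
  obtain ⟨z, hz⟩ := hy e
  obtain ⟨w, hw⟩ := hh e
  refine ⟨z + ⌈a * c⌉ * w, ?_⟩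
  rw [smul_smul, heq]
  simp [hz, hw]

end LinSystem

/-! ### Fractional entries and arrays with zero margins -/

theorem exists_ne_not_int_of_sum_int {α : Type*} [DecidableEq α] {s : Finset α} {f : α → ℝ}
    {a : α} (hs : ∃ z : ℤ, ∑ b ∈ s, f b = z) (ha : a ∈ s) (hfa : ¬ ∃ z : ℤ, f a = z) :
    ∃ b ∈ s, b ≠ a ∧ ¬ ∃ z : ℤ, f b = z := by
  by_contra! hcon
  obtain ⟨z, hz⟩ := hs
  rw [← Finset.add_sum_erase s f ha] at hz
  have hmem : ∑ b ∈ s.erase a, f b ∈ (Int.castRingHom ℝ).range := by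
    refine sum_mem fun b hb => ?_
    obtain ⟨w, hw⟩ := hcon b (Finset.mem_of_mem_erase hb) (Finset.ne_of_mem_erase hb)
    exact ⟨w, hw.symm⟩
  obtain ⟨w, hw⟩ := hmem
  refine hfa ⟨z - w, ?_⟩
  simp only [eq_intCast] at hw
  push_cast
  linarith

theorem Finset.two_mul_card_image_le_card {α β : Type*} [DecidableEq β] {s : Finset α} {f : α → β}
    (h : ∀ a ∈ s, ∃ b ∈ s, b ≠ a ∧ f b = f a) : 2 * (s.image f).card ≤ s.card := by
  classical
  rw [Finset.card_eq_sum_card_image f s, mul_comm, ← smul_eq_mul]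
  refine Finset.card_nsmul_le_sum _ _ _ fun c hc => ?_
  obtain ⟨a, ha, rfl⟩ := Finset.mem_image.1 hc
  obtain ⟨b, hb, hba, hf⟩ := h a ha
  exact Finset.one_lt_card.2 ⟨a, by simp [ha], b, by simp [hb, hf], hba.symm⟩

/-- If every row and every column that meets a nonempty set `F` of cells meets it at least twice,
then some nonzero array supported on `F` has vanishing row and column sums. -/
theorem exists_ne_zero_of_two_le_rows_cols {m n : ℕ} {F : Finset (Fin m × Fin n)}
    (hF : F.Nonempty) (hr : ∀ a ∈ F, ∃ b ∈ F, b ≠ a ∧ b.1 = a.1)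
    (hc : ∀ a ∈ F, ∃ b ∈ F, b ≠ a ∧ b.2 = a.2) :
    ∃ h : Fin m × Fin n → ℝ, h ≠ 0 ∧ (∀ c ∉ F, h c = 0) ∧ (∀ i, ∑ j, h (i, j) = 0) ∧
      ∀ j, ∑ i, h (i, j) = 0 := by
  classical
  set R := F.image Prod.fst with hR
  set C := F.image Prod.snd with hC
  obtain ⟨c₀, hc₀⟩ := hF
  have hcR : 2 * R.card ≤ F.card := Finset.two_mul_card_image_le_card hr
  have hcC : 2 * C.card ≤ F.card := Finset.two_mul_card_image_le_card hc
  have hr₀ : c₀.1 ∈ R := Finset.mem_image_of_mem _ hc₀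
  let ext : (F → ℝ) →ₗ[ℝ] (Fin m × Fin n → ℝ) :=
    Function.ExtendByZero.linearMap ℝ (Subtype.val : F → Fin m × Fin n)
  let φ : (Fin m × Fin n → ℝ) →ₗ[ℝ] (R.erase c₀.1 → ℝ) × (C → ℝ) :=
    (LinearMap.pi fun i => ∑ j, LinearMap.proj (i.1, j)).prod
      (LinearMap.pi fun j => ∑ i, LinearMap.proj (i, j.1))
  -- `F` has at least `|R| + |C|` cells. Dropping one row equation, which the others imply, leaves
  -- fewer equations than unknowns.
  have hlt : Module.finrank ℝ ((R.erase c₀.1 → ℝ) × (C → ℝ)) < Module.finrank ℝ (F → ℝ) := by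
    have := Finset.card_erase_lt_of_mem hr₀
    simp only [Module.finrank_prod, Module.finrank_fintype_fun_eq_card, Fintype.card_coe]
    omega
  obtain ⟨x, hx, hx0⟩ := (Submodule.ne_bot_iff _).1
    (LinearMap.ker_ne_bot_of_finrank_lt (f := φ ∘ₗ ext) hlt)
  have hext : ∀ c : F, ext x c = x c := fun c => Subtype.val_injective.extend_apply _ _ _
  have hext0 : ∀ c ∉ F, ext x c = 0 := fun c hcF =>
    Function.extend_apply' _ _ _ (by rintro ⟨a, rfl⟩; exact hcF a.2)
  have hφ : φ (ext x) = 0 := hx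
  have hcol : ∀ j, ∑ i, ext x (i, j) = 0 := by
    intro j
    by_cases hj : j ∈ C
    · simpa [φ] using congrFun (congrArg Prod.snd hφ) ⟨j, hj⟩
    · exact Finset.sum_eq_zero fun i _ => hext0 _ fun h => hj (Finset.mem_image_of_mem _ h)
  have hrow : ∀ i ≠ c₀.1, ∑ j, ext x (i, j) = 0 := by
    intro i hi
    by_cases hi' : i ∈ R
    · simpa [φ] using congrFun (congrArg Prod.fst hφ) ⟨i, Finset.mem_erase.2 ⟨hi, hi'⟩⟩
    · exact Finset.sum_eq_zero fun j _ => hext0 _ fun h => hi' (Finset.mem_image_of_mem _ h)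
  refine ⟨ext x, fun h0 => hx0 (funext fun c => ?_), hext0, fun i => ?_, hcol⟩
  · rw [← hext, h0]; rfl
  · by_cases hi : i = c₀.1
    · have htot : ∑ i, ∑ j, ext x (i, j) = 0 := by
        rw [Finset.sum_comm]
        exact Finset.sum_eq_zero fun j _ => hcol j
      rw [hi, ← htot]
      exact (Finset.sum_eq_single _ (fun i _ hi => hrow i hi) (by simp)).symm
    · exact hrow i hi

/-! ### Transportation polytopes and their integrality -/

section Transportation

variable {m n : ℕ} {u : Fin m → ℕ} {v : Fin n → ℕ}

theorem transportationSystem_mulVec_A_inl (y : Fin m × Fin n → ℝ) (i : Fin m) :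
    (transportationSystem u v).A.mulVec y (Sum.inl i) = ∑ j, y (i, j) := by
  simp only [transportationSystem, Matrix.mulVec, dotProduct, Fintype.sum_prod_type,
    Matrix.of_apply, Sum.elim_inl, ite_mul, one_mul, zero_mul]
  rw [Finset.sum_eq_single i (fun i' _ hi => by simp [hi]) (by simp)]
  simp

theorem transportationSystem_mulVec_A_inr (y : Fin m × Fin n → ℝ) (j : Fin n) :
    (transportationSystem u v).A.mulVec y (Sum.inr j) = ∑ i, y (i, j) := by
  simp [transportationSystem, Matrix.mulVec, dotProduct, Fintype.sum_prod_type]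

theorem transportationSystem_mulVec_B (y : Fin m × Fin n → ℝ) (c : Fin m × Fin n) :
    (transportationSystem u v).B.mulVec y c = -y c := by
  simp [transportationSystem, Matrix.mulVec, dotProduct]

theorem transportationSystem_mulVec_A_eq_zero {y : Fin m × Fin n → ℝ} :
    (transportationSystem u v).A.mulVec y = 0 ↔
      (∀ i, ∑ j, y (i, j) = 0) ∧ ∀ j, ∑ i, y (i, j) = 0 := by
  simp [funext_iff, transportationSystem_mulVec_A_inl, transportationSystem_mulVec_A_inr]

theorem mem_polyhedron_transportationSystem {y : Fin m × Fin n → ℝ} :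
    y ∈ (transportationSystem u v).polyhedron ↔
      (∀ i, ∑ j, y (i, j) = u i) ∧ (∀ j, ∑ i, y (i, j) = v j) ∧ ∀ c, 0 ≤ y c := by
  simp [LinSystem.polyhedron, funext_iff, transportationSystem_mulVec_A_inl, Pi.le_def,
    transportationSystem_mulVec_A_inr, transportationSystem_mulVec_B, and_assoc]
  simp [transportationSystem]

theorem transportationSystem_mulVec_B_eq_zero (x : Fin m × Fin n → ℝ)
    (hx : (transportationSystem u v).B.mulVec x = 0) : x = 0 := by
  ext c
  simpa [transportationSystem_mulVec_B] using congrFun hx c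

/-- Transportation polytopes with integral margins are integral. -/
theorem transportationSystem_isGCW (u : Fin m → ℕ) (v : Fin n → ℕ) :
    (transportationSystem u v).IsGCW := by
  classical
  intro y hy
  by_contra hcon
  obtain ⟨hrow, hcol, hpos⟩ := mem_polyhedron_transportationSystem.1 hy.1
  simp only [IsIntegerVec, not_forall] at hcon
  obtain ⟨c₀, hc₀⟩ := hcon
  -- As the margins are integers, no line contains exactly one fractional cell. An array supported
  -- on `F` vanishes at all tight cells, since those are zero in `y`.
  set F : Finset (Fin m × Fin n) := Finset.univ.filter fun c => ¬ ∃ z : ℤ, y c = z with hF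
  obtain ⟨h, h0, hF0, hr, hc⟩ := exists_ne_zero_of_two_le_rows_cols (F := F)
    ⟨c₀, by simpa [hF] using hc₀⟩
    (fun a ha => by
      obtain ⟨j, -, hj, hj'⟩ := exists_ne_not_int_of_sum_int (f := fun j => y (a.1, j))
        ⟨u a.1, by simpa using hrow a.1⟩ (Finset.mem_univ a.2) (Finset.mem_filter.1 ha).2
      exact ⟨(a.1, j), by simpa [hF] using hj', fun h => hj (congrArg Prod.snd h), rfl⟩)
    (fun a ha => by
      obtain ⟨j, -, hj, hj'⟩ := exists_ne_not_int_of_sum_int (f := fun i => y (i, a.2))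
        ⟨v a.2, by simpa using hcol a.2⟩ (Finset.mem_univ a.1) (Finset.mem_filter.1 ha).2
      exact ⟨(j, a.2), by simpa [hF] using hj', fun h => hj (congrArg Prod.fst h), rfl⟩)
  refine h0 (hy.eq_zero_of_tight (transportationSystem_mulVec_A_eq_zero.2 ⟨hr, hc⟩) fun c hc => ?_)
  rw [transportationSystem_mulVec_B] at hc ⊢
  rw [hF0 c, neg_zero]
  simp only [hF, Finset.mem_filter, Finset.mem_univ, true_and, not_not]
  exact ⟨0, by simpa [transportationSystem] using hc⟩

end Transportation

/-! ### Edges, and fixed-size partition polytopes -/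

/-- The maximal step from a vertex of a polyhedron along a direction `g` traverses an edge if
some coordinate face contains the vertex and only the line in direction `g`. -/
theorem LinSystem.isEdge_of_face {p q ι : Type} [Fintype ι] {P : LinSystem p q ι}
    {y g : ι → ℝ} {a : ℝ} {T : Finset ι} (hy : P.IsVertex y) (hg : g ≠ 0) (ha : 0 < a)
    (hmem : y + a • g ∈ P.polyhedron) (hmax : ∀ a', a < a' → y + a' • g ∉ P.polyhedron)
    (hpos : ∀ x ∈ P.polyhedron, ∀ e ∈ T, 0 ≤ x e) (hyT : ∀ e ∈ T, y e = 0)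
    (hgT : ∀ e ∈ T, g e = 0)
    (hline : ∀ x ∈ P.polyhedron, (∀ e ∈ T, x e = 0) → ∃ c : ℝ, x = y + c • g) :
    P.IsEdge y (y + a • g) := by
  have hne : ∀ {c : ℝ}, c ≠ 0 → y + c • g ≠ y := fun hc h => by
    rw [add_eq_left, smul_eq_zero] at h
    exact h.elim hc hg
  have hseg : ∀ x, x ∈ segment ℝ y (y + a • g) ↔
      x ∈ P.polyhedron ∧ ∀ e ∈ T, x e = 0 := by
    intro x
    rw [segment_eq_image']
    constructor
    · rintro ⟨θ, ⟨hθ0, hθ1⟩, rfl⟩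
      simp only [add_sub_cancel_left]
      refine ⟨⟨?_, fun i => ?_⟩, fun e he => by simp [hyT e he, hgT e he]⟩
      · have h1 := hy.1.1
        have h2 := hmem.1
        rw [Matrix.mulVec_add, h1, add_eq_left] at h2
        rw [Matrix.mulVec_add, Matrix.mulVec_smul, h2, h1, smul_zero, add_zero]
      · have h1 := hy.1.2 i
        have h2 := hmem.2 i
        simp only [Matrix.mulVec_add, Matrix.mulVec_smul, Pi.add_apply, Pi.smul_apply,
          smul_eq_mul] at h2 ⊢
        nlinarith [mul_le_mul_of_nonneg_left h2 hθ0,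
          mul_le_mul_of_nonneg_left h1 (sub_nonneg.2 hθ1)]
    · rintro ⟨hxP, hxT⟩
      obtain ⟨c, rfl⟩ := hline x hxP hxT
      have hca : c ≤ a := not_lt.1 fun h => hmax c h hxP
      -- For negative `c` the vertex `y` would lie strictly between `y + c • g` and `y + a • g`.
      have hc0 : 0 ≤ c := by
        by_contra! hc
        refine hne hc.ne (hy.2 hxP hmem ⟨a / (a - c), -c / (a - c), ?_, ?_, ?_, ?_⟩)
        · exact div_pos ha (by linarith)
        · exact div_pos (by linarith) (by linarith)
        · have : a - c ≠ 0 := by linarith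
          field_simp
          ring
        · have : a - c ≠ 0 := by linarith
          ext e
          simp only [Pi.add_apply, Pi.smul_apply, smul_eq_mul]
          field_simp
          ring
      refine ⟨c / a, ⟨by positivity, (div_le_one ha).2 hca⟩, ?_⟩
      simp only [add_sub_cancel_left, smul_smul, div_mul_cancel₀ _ ha.ne']
  have hexp : IsExposed ℝ P.polyhedron (segment ℝ y (y + a • g)) := by
    intro _
    -- The coordinates in `T` are nonnegative on the polyhedron, so the maximum 0 is attained
    -- exactly where they all vanish.
    let l : StrongDual ℝ (ι → ℝ) := -∑ e ∈ T, ContinuousLinearMap.proj e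
    have hl : ∀ x, l x = -∑ e ∈ T, x e := fun x => by simp [l]
    refine ⟨l, Set.ext fun x => (hseg x).trans ⟨fun ⟨hx, hxT⟩ => ⟨hx, fun w hw => ?_⟩,
      fun ⟨hx, hxl⟩ => ⟨hx, ?_⟩⟩⟩
    · rw [hl, hl, Finset.sum_eq_zero hxT]
      simpa using Finset.sum_nonneg (hpos w hw)
    · have := hxl y hy.1
      rw [hl, hl, Finset.sum_eq_zero hyT, neg_le_neg_iff] at this
      exact (Finset.sum_eq_zero_iff_of_nonneg (hpos x hx)).1
        (this.antisymm (Finset.sum_nonneg (hpos x hx)))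
  refine ⟨hy, ?_, (hne ha.ne').symm, hexp⟩
  refine hexp.isExtreme.extremePoints_subset_extremePoints ⟨right_mem_segment _ _ _, ?_⟩
  intro x₁ hx₁ x₂ hx₂ hx
  rw [segment_eq_image'] at hx₁ hx₂
  obtain ⟨θ₁, ⟨-, h₁⟩, rfl⟩ := hx₁
  obtain ⟨θ₂, ⟨-, h₂⟩, rfl⟩ := hx₂
  obtain ⟨α, β, hα, hβ, hαβ, hx⟩ := hx
  have hβ' : β = 1 - α := by linarith
  subst hβ'
  have hkey : (α * θ₁ + (1 - α) * θ₂ - 1) • a • g = 0 := by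
    rw [← sub_eq_zero] at hx
    rw [← hx]
    ext e
    simp only [Pi.add_apply, Pi.smul_apply, Pi.sub_apply, smul_eq_mul]
    ring
  rw [smul_smul, smul_eq_zero, or_iff_left hg, mul_eq_zero, or_iff_left ha.ne'] at hkey
  have : θ₁ = 1 := by
    refine h₁.antisymm ?_
    nlinarith [mul_le_mul_of_nonneg_left h₂ hβ.le]
  simp [this]

theorem fixedSizePartitionSystem_isECW (k n : ℕ) (κ : Fin k → ℕ) :
    (fixedSizePartitionSystem n κ).IsECW := by
  classical
  have hGCW : (fixedSizePartitionSystem n κ).IsGCW := transportationSystem_isGCW κ _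
  have hstep : ∀ (y g : Fin k × Fin n → ℝ) (a : ℝ), (fixedSizePartitionSystem n κ).IsVertex y →
      (fixedSizePartitionSystem n κ).IsCircuit g → 0 < a →
      y + a • g ∈ (fixedSizePartitionSystem n κ).polyhedron →
      (∀ a', a < a' → y + a' • g ∉ (fixedSizePartitionSystem n κ).polyhedron) →
      (fixedSizePartitionSystem n κ).IsEdge y (y + a • g) := by
    intro y g a hy hg ha hmem hmax
    have hint := hGCW y hy
    obtain ⟨hyr, hyc, hy0⟩ := mem_polyhedron_transportationSystem.1 hy.1
    obtain ⟨-, -, hz0⟩ := mem_polyhedron_transportationSystem.1 hmem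
    obtain ⟨-, hgc⟩ := transportationSystem_mulVec_A_eq_zero.1 hg.2.1
    have hone : ∀ j, ∃ i, y (i, j) = 1 ∧ ∀ i' ≠ i, y (i', j) = 0 := by
      intro j
      have hsum : ∑ i, y (i, j) = 1 := by simpa using hyc j
      obtain ⟨i, -, hi⟩ : ∃ i ∈ Finset.univ, y (i, j) ≠ 0 := by
        by_contra! hcon
        rw [Finset.sum_eq_zero hcon] at hsum
        exact zero_ne_one hsum
      have hpos := (hy0 (i, j)).lt_of_ne' hi
      obtain ⟨z, hz⟩ := hint (i, j)
      have h1 : 1 ≤ y (i, j) := by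
        rw [hz] at hpos ⊢
        exact_mod_cast Int.add_one_le_iff.2 (by exact_mod_cast hpos : 0 < z)
      rw [← Finset.add_sum_erase _ _ (Finset.mem_univ i)] at hsum
      have hnn : 0 ≤ ∑ i' ∈ Finset.univ.erase i, y (i', j) :=
        Finset.sum_nonneg fun i' _ => hy0 _
      refine ⟨i, by linarith, fun i' hi' => ?_⟩
      refine (Finset.sum_eq_zero_iff_of_nonneg fun i' _ => hy0 (i', j)).1
        (by linarith : ∑ i' ∈ Finset.univ.erase i, y (i', j) = 0) i' (by simp [hi'])
    choose σ hσ1 hσ0 using hone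
    -- Off `σ j` the column of `y` is zero, so feasibility of the step makes `g` nonnegative there;
    -- its column sum is zero.
    have hgcol : ∀ j, g (σ j, j) = 0 → ∀ i, g (i, j) = 0 := by
      intro j hj i
      have hnn : ∀ i, 0 ≤ g (i, j) := by
        intro i
        by_cases hi : i = σ j
        · rw [hi, hj]
        · have := hz0 (i, j)
          simp only [Pi.add_apply, Pi.smul_apply, smul_eq_mul, hσ0 j i hi, zero_add] at this
          exact nonneg_of_mul_nonneg_right this ha
      exact (Finset.sum_eq_zero_iff_of_nonneg fun i _ => hnn i).1 (hgc j) i (Finset.mem_univ i)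
    refine LinSystem.isEdge_of_face (T := Finset.univ.filter fun c => y c = 0 ∧ g c = 0) hy hg.2.2.1
      ha hmem hmax (fun x hx e _ => (mem_polyhedron_transportationSystem.1 hx).2.2 e)
      (fun e he => (Finset.mem_filter.1 he).2.1) (fun e he => (Finset.mem_filter.1 he).2.2)
      fun x hx hxT => ?_
    obtain ⟨hxr, hxc, hx0⟩ := mem_polyhedron_transportationSystem.1 hx
    by_cases hxy : x - y = 0
    · exact ⟨0, by rw [sub_eq_zero.1 hxy]; simp⟩
    obtain ⟨c, hc⟩ := hg.eq_smul (h := x - y) transportationSystem_mulVec_B_eq_zero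
      (by rw [Matrix.mulVec_sub, hx.1, hy.1.1, sub_self]) hxy (by
        rintro ⟨i, j⟩ hij
        erw [transportationSystem_mulVec_B, neg_eq_zero] at hij ⊢
        rw [Pi.sub_apply, sub_eq_zero]
        by_cases hi : i = σ j
        · subst hi
          have hcol := hgcol j hij
          -- The whole column of `g` vanishes here, so `x` is zero off `σ j` and the column sum
          -- forces the entry 1, as in `y`.
          have h1 : ∑ i, x (i, j) = x (σ j, j) := Finset.sum_eq_single _
            (fun i _ hi => hxT _ (by simp [hσ0 j i hi, hcol i])) (by simp)
          rw [hσ1, ← h1, hxc j, Nat.cast_one]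
        · rw [hσ0 j i hi, hxT _ (by simp [hσ0 j i hi, hij])])
    have hc0 : c ≠ 0 := by
      rintro rfl
      exact hg.2.2.1 (by simpa using hc)
    exact ⟨c⁻¹, by rw [hc, smul_smul, inv_mul_cancel₀ hc0, one_smul, add_sub_cancel]⟩
  refine ⟨hGCW, fun N y hy i => ?_⟩
  have hv : ∀ i, (fixedSizePartitionSystem n κ).IsVertex (y i) :=
    hy.induction (fun _ h => h) fun x g a hx _ hg ha hmem hmax =>
      (hstep x g a hx hg ha hmem hmax).2.1
  obtain ⟨-, g, a, hg, ha, hi, hmax⟩ := hy.2.2 i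
  have := hy.mem i.succ
  rw [hi] at this ⊢
  exact hstep _ g a (hv _) hg ha this hmax

/-! ### Two-row arrays and column exchanges -/

/-- The array with the two rows `w` and `-w`. -/
def twoRow {n : ℕ} (w : Fin n → ℝ) : Fin 2 × Fin n → ℝ := fun c => ![w c.2, -w c.2] c.1

section TwoRow

variable {n : ℕ}

@[simp] theorem twoRow_zero (w : Fin n → ℝ) (j : Fin n) : twoRow w (0, j) = w j := rfl

@[simp] theorem twoRow_one (w : Fin n → ℝ) (j : Fin n) : twoRow w (1, j) = -w j := rfl

theorem twoRow_col (w : Fin n → ℝ) (j : Fin n) : ∑ i, twoRow w (i, j) = 0 := by simp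

theorem twoRow_row {w : Fin n → ℝ} (hw : ∑ j, w j = 0) (i : Fin 2) :
    ∑ j, twoRow w (i, j) = 0 := by
  fin_cases i <;> simp [hw]

theorem eq_twoRow {g : Fin 2 × Fin n → ℝ} (hg : ∀ j, ∑ i, g (i, j) = 0) :
    g = twoRow fun j => g (0, j) := by
  ext ⟨i, j⟩
  have := hg j
  rw [Fin.sum_univ_two] at this
  fin_cases i
  · rfl
  · simp only [Fin.mk_one, twoRow_one]
    linarith

theorem isIntegerVec_twoRow {w : Fin n → ℝ} (hw : IsIntegerVec w) : IsIntegerVec (twoRow w) := by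
  rintro ⟨i, j⟩
  obtain ⟨z, hz⟩ := hw j
  fin_cases i
  · exact ⟨z, by simpa using hz⟩
  · exact ⟨-z, by simp [hz]⟩

theorem twoRow_ne_zero {w : Fin n → ℝ} {j : Fin n} (hj : w j ≠ 0) : twoRow w ≠ 0 :=
  fun h => hj (congrFun h (0, j))

theorem twoRow_eq_or {w : Fin n → ℝ} (hw : ∀ j, w j = -1 ∨ w j = 0 ∨ w j = 1)
    (c : Fin 2 × Fin n) : -twoRow w c = -1 ∨ -twoRow w c = 0 ∨ -twoRow w c = 1 := by
  obtain ⟨i, j⟩ := c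
  fin_cases i <;> rcases hw j with h | h | h <;> simp [h]

/-- The difference of two unit vectors. -/
def unitDiff (j k : Fin n) : Fin n → ℝ := Pi.single j 1 - Pi.single k 1

theorem unitDiff_left {j k : Fin n} (h : j ≠ k) : unitDiff j k j = 1 := by simp [unitDiff, h]

theorem unitDiff_right {j k : Fin n} (h : j ≠ k) : unitDiff j k k = -1 := by
  simp [unitDiff, h.symm]

theorem unitDiff_of_ne {j k l : Fin n} (hj : l ≠ j) (hk : l ≠ k) : unitDiff j k l = 0 := by
  simp [unitDiff, hj, hk]

theorem sum_unitDiff (j k : Fin n) : ∑ l, unitDiff j k l = 0 := by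
  simp [unitDiff, Finset.sum_sub_distrib]

theorem unitDiff_eq_or {j k : Fin n} (h : j ≠ k) (l : Fin n) :
    unitDiff j k l = -1 ∨ unitDiff j k l = 0 ∨ unitDiff j k l = 1 := by
  rcases eq_or_ne l j with rfl | hj
  · exact Or.inr (Or.inr (unitDiff_left h))
  rcases eq_or_ne l k with rfl | hk
  · exact Or.inl (unitDiff_right h)
  · exact Or.inr (Or.inl (unitDiff_of_ne hj hk))

theorem isIntegerVec_unitDiff {j k : Fin n} (h : j ≠ k) : IsIntegerVec (unitDiff j k) := by
  intro l
  rcases unitDiff_eq_or h l with h | h | h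
  · exact ⟨-1, by simp [h]⟩
  · exact ⟨0, by simp [h]⟩
  · exact ⟨1, by simp [h]⟩

theorem eq_smul_twoRow_unitDiff {j k : Fin n} (h : j ≠ k) {x : Fin 2 × Fin n → ℝ}
    (hcol : ∀ j, ∑ i, x (i, j) = 0) (hrow : ∑ j, x (0, j) = 0)
    (hx : ∀ l, l ≠ j → l ≠ k → x (0, l) = 0) : x = x (0, j) • twoRow (unitDiff j k) := by
  have hk : x (0, k) = -x (0, j) := by
    rw [Fintype.sum_eq_add j k h fun l hl => hx l hl.1 hl.2] at hrow
    linarith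
  have key : ∀ l, x (0, l) = x (0, j) * unitDiff j k l := by
    intro l
    rcases eq_or_ne l j with rfl | hlj
    · rw [unitDiff_left h, mul_one]
    rcases eq_or_ne l k with rfl | hlk
    · rw [unitDiff_right h, hk]; ring
    · rw [unitDiff_of_ne hlj hlk, hx l hlj hlk, mul_zero]
  rw [eq_twoRow hcol]
  ext ⟨i, l⟩
  fin_cases i <;> simp [key l]

theorem exists_ne_of_sum_eq_zero {w : Fin n → ℝ} (hw : ∑ j, w j = 0) {j : Fin n}
    (hj : w j ≠ 0) : ∃ k, j ≠ k ∧ w k ≠ 0 := by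
  by_contra! hcon
  rw [Finset.sum_eq_single j (fun k _ hk => hcon k hk.symm) (by simp)] at hw
  exact hj hw

/-- Provides the support condition of `IsCircuit.eq_smul`: with zero column sums, both entries of a
column vanish together. -/
theorem twoRow_unitDiff_apply_eq_zero {g : Fin 2 × Fin n → ℝ} (hg : ∀ j, ∑ i, g (i, j) = 0)
    {j k : Fin n} (hj : g (0, j) ≠ 0) (hk : g (0, k) ≠ 0) {c : Fin 2 × Fin n} (hc : g c = 0) :
    twoRow (unitDiff j k) c = 0 := by
  obtain ⟨i, l⟩ := c
  have hl : g (0, l) = 0 := by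
    have := hg l
    rw [Fin.sum_univ_two] at this
    fin_cases i
    · exact hc
    · simp only [Fin.mk_one] at hc
      linarith
  have h0 : unitDiff j k l = 0 :=
    unitDiff_of_ne (by rintro rfl; exact hj hl) (by rintro rfl; exact hk hl)
  fin_cases i <;> simp [h0]

end TwoRow

theorem Finset.gcd_eq_one_of_apply_eq_one {ι : Type*} {s : Finset ι} {z : ι → ℤ} {e : ι}
    (he : e ∈ s) (h : z e = 1) : s.gcd z = 1 := by
  rw [← Finset.normalize_gcd, normalize_eq_one]
  exact isUnit_of_dvd_one (h ▸ Finset.gcd_dvd he)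

theorem LinSystem.isCircuit_twoRow_unitDiff {p q : Type} {n : ℕ}
    {P : LinSystem p q (Fin 2 × Fin n)} {j k : Fin n} (h : j ≠ k)
    (hA : P.A.mulVec (twoRow (unitDiff j k)) = 0)
    (hmin : ∀ x, P.A.mulVec x = 0 →
      (∀ i, P.B.mulVec (twoRow (unitDiff j k)) i = 0 → P.B.mulVec x i = 0) →
      (∀ j, ∑ i, x (i, j) = 0) ∧ ∑ j, x (0, j) = 0 ∧ ∀ l, l ≠ j → l ≠ k → x (0, l) = 0) :
    P.IsCircuit (twoRow (unitDiff j k)) := by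
  choose z hz using isIntegerVec_twoRow (isIntegerVec_unitDiff h)
  refine LinSystem.isCircuit_of_forall z hz
    (Finset.gcd_eq_one_of_apply_eq_one (Finset.mem_univ ((0 : Fin 2), j)) ?_) hA
    (twoRow_ne_zero (j := j) (by simp [unitDiff_left h])) fun x hxA hxB => ?_
  · have := hz (0, j)
    rw [twoRow_zero, unitDiff_left h] at this
    exact_mod_cast this.symm
  · obtain ⟨h1, h2, h3⟩ := hmin x hxA hxB
    exact ⟨_, eq_smul_twoRow_unitDiff h h1 h2 h3⟩

/-! ### Two-row transportation polytopes: integral walks that leave the vertices -/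

/-- The first row of a circuit sums to zero, so it has two nonzero entries; the exchange of these
columns is supported in the circuit and hence parallel to it. -/
theorem transportationSystem_two_isICW {n : ℕ} (u : Fin 2 → ℕ) (v : Fin n → ℕ) :
    (transportationSystem u v).IsICW := by
  refine ⟨transportationSystem_isGCW u v, fun k y hy => hy.induction
    (transportationSystem_isGCW u v) fun x g a hx hxP hg ha hmem hmax => ?_⟩
  obtain ⟨hr, hc⟩ := transportationSystem_mulVec_A_eq_zero.1 hg.2.1
  obtain ⟨j, hj⟩ : ∃ j, g (0, j) ≠ 0 := by
    by_contra! hcon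
    refine hg.2.2.1 ?_
    rw [eq_twoRow hc]
    ext ⟨i, j⟩
    fin_cases i <;> simp [hcon]
  obtain ⟨l, hjl, hl⟩ := exists_ne_of_sum_eq_zero (hr 0) hj
  have hA : (transportationSystem u v).A.mulVec (twoRow (unitDiff j l)) = 0 :=
    transportationSystem_mulVec_A_eq_zero.2 ⟨twoRow_row (sum_unitDiff j l), twoRow_col _⟩
  obtain ⟨c, hc⟩ := hg.eq_smul (h := twoRow (unitDiff j l)) transportationSystem_mulVec_B_eq_zero
    hA (twoRow_ne_zero (j := j) (by simp [unitDiff_left hjl])) fun i hi => by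
      rw [transportationSystem_mulVec_B, neg_eq_zero] at hi ⊢
      exact twoRow_unitDiff_apply_eq_zero hc hj hl hi
  refine LinSystem.isIntegerVec_step (fun i => ⟨0, by simp [transportationSystem]⟩) (fun i => ?_) hx
    (isIntegerVec_twoRow (isIntegerVec_unitDiff hjl)) hA (fun i => ?_) hxP hg.2.2.1 hc ha hmem hmax
  · obtain ⟨z, hz⟩ := hx i
    exact ⟨-z, by rw [transportationSystem_mulVec_B, hz]; push_cast; rfl⟩
  · rw [transportationSystem_mulVec_B]
    exact twoRow_eq_or (unitDiff_eq_or hjl) i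

theorem transportationSystem_isCircuit_twoRow {n : ℕ} {u : Fin 2 → ℕ} {v : Fin n → ℕ}
    {j k : Fin n} (h : j ≠ k) :
    (transportationSystem u v).IsCircuit (twoRow (unitDiff j k)) := by
  refine LinSystem.isCircuit_twoRow_unitDiff h
    (transportationSystem_mulVec_A_eq_zero.2 ⟨twoRow_row (sum_unitDiff j k), twoRow_col _⟩)
    fun x hxA hxB => ?_
  obtain ⟨hr, hc⟩ := transportationSystem_mulVec_A_eq_zero.1 hxA
  refine ⟨hc, hr 0, fun l hj hk => ?_⟩
  have := hxB (0, l)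
  simpa [transportationSystem_mulVec_B, unitDiff_of_ne hj hk] using this

theorem not_isVCW_transportationSystem :
    ¬ (transportationSystem ![3, 2] ![1, 2, 2]).IsVCW := by
  intro hV
  have hmem : ∀ y : Fin 2 × Fin 3 → ℝ,
      y ∈ (transportationSystem ![3, 2] ![1, 2, 2]).polyhedron ↔
      (y (0, 0) + y (0, 1) + y (0, 2) = 3 ∧ y (1, 0) + y (1, 1) + y (1, 2) = 2) ∧
      (y (0, 0) + y (1, 0) = 1 ∧ y (0, 1) + y (1, 1) = 2 ∧ y (0, 2) + y (1, 2) = 2) ∧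
      ∀ i j, 0 ≤ y (i, j) := by
    intro y
    rw [mem_polyhedron_transportationSystem]
    simp [Fin.forall_fin_succ, Fin.sum_univ_succ, add_assoc]
  have hvert : ∀ y : Fin 2 × Fin 3 → ℝ,
      y ∈ (transportationSystem ![3, 2] ![1, 2, 2]).polyhedron →
      (y (0, 0) = 0 ∧ y (1, 2) = 0 ∨ y (1, 0) = 0 ∧ y (0, 2) = 0) →
      (transportationSystem ![3, 2] ![1, 2, 2]).IsVertex y := by
    intro y hy h0
    refine LinSystem.isVertex_of_tight hy fun h hA hB => ?_
    obtain ⟨hr, hc⟩ := transportationSystem_mulVec_A_eq_zero.1 hA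
    have hz : ∀ c, y c = 0 → h c = 0 := fun c hc => by
      have := hB c (by rw [transportationSystem_mulVec_B, hc]; simp [transportationSystem])
      simpa [transportationSystem_mulVec_B] using this
    simp only [Fin.forall_fin_succ, Fin.sum_univ_succ, Fin.sum_univ_zero, IsEmpty.forall_iff,
      Fin.succ_zero_eq_one, Fin.succ_one_eq_two] at hr hc
    have : h (0, 0) = 0 ∧ h (0, 2) = 0 := by
      rcases h0 with ⟨h1, h2⟩ | ⟨h1, h2⟩
      · have h1 := hz _ h1
        have h2 := hz _ h2
        exact ⟨h1, by linarith⟩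
      · have h1 := hz _ h1
        have h2 := hz _ h2
        exact ⟨by linarith, h2⟩
    ext ⟨i, j⟩
    fin_cases i <;> fin_cases j <;> simp <;> linarith
  -- Both steps take a unit out of column 2 of the first row, the first into column 0, the second
  -- into column 1. The middle array is positive in all of columns 1 and 2, so exchanging these
  -- moves it both ways.
  let y : Fin 3 → Fin 2 × Fin 3 → ℝ := fun t c =>
    ![![![0, 1, 2], ![1, 1, 0]], ![![1, 1, 1], ![0, 1, 1]], ![![1, 2, 0], ![0, 0, 2]]] t c.1 c.2
  have hy : ∀ t, y t ∈ (transportationSystem ![3, 2] ![1, 2, 2]).polyhedron := by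
    intro t
    rw [hmem]
    fin_cases t <;> simp [y, Fin.forall_fin_succ] <;> norm_num
  have hwalk : (transportationSystem ![3, 2] ![1, 2, 2]).IsCircuitWalk y := by
    refine ⟨hvert _ (hy _) (by simp [y]), hvert _ (hy _) (by simp [y, Fin.last]), fun t => ?_⟩
    refine ⟨hy _, twoRow (unitDiff (![0, 1] t) 2), 1, transportationSystem_isCircuit_twoRow ?_,
      one_pos, ?_, fun a' ha' hcon => ?_⟩
    · fin_cases t <;> decide
    · ext ⟨i, j⟩
      fin_cases t <;> fin_cases i <;> fin_cases j <;> simp [y, unitDiff] <;>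
        norm_num
    · have h0 := ((hmem _).1 hcon).2.2
      fin_cases t
      · have := h0 1 0
        simp [y, unitDiff] at this
        linarith
      · have := h0 0 2
        simp [y, unitDiff] at this
        linarith
  have hv := hV.2 2 y hwalk 1
  have := hv.eq_zero_of_tight (h := twoRow (unitDiff 1 2))
    (transportationSystem_mulVec_A_eq_zero.2 ⟨twoRow_row (sum_unitDiff 1 2), twoRow_col _⟩)
    (by
      rintro ⟨i, j⟩ hij
      rw [transportationSystem_mulVec_B] at hij ⊢
      fin_cases i <;> fin_cases j <;>
        simp [y, transportationSystem, unitDiff] at hij ⊢)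
  have := congrFun this (0, 1)
  simp [unitDiff] at this

/-! ### Bounded-size partition polytopes -/

section BoundedSize

variable {k n : ℕ} {l u : Fin k → ℕ}

theorem boundedSizePartitionSystem_mulVec_A (y : Fin k × Fin n → ℝ) (j : Fin n) :
    (boundedSizePartitionSystem n l u).A.mulVec y j = ∑ i, y (i, j) := by
  simp [boundedSizePartitionSystem, Matrix.mulVec, dotProduct, Fintype.sum_prod_type]

theorem boundedSizePartitionSystem_mulVec_B_inl (y : Fin k × Fin n → ℝ) (i : Fin k) :
    (boundedSizePartitionSystem n l u).B.mulVec y (Sum.inl i) = -∑ j, y (i, j) := by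
  simp only [boundedSizePartitionSystem, Matrix.mulVec, dotProduct, Fintype.sum_prod_type,
    Matrix.of_apply, Sum.elim_inl, ite_mul, neg_mul, one_mul, zero_mul]
  rw [Finset.sum_eq_single i (fun i' _ hi => by simp [hi]) (by simp)]
  simp

theorem boundedSizePartitionSystem_mulVec_B_inr_inl (y : Fin k × Fin n → ℝ) (i : Fin k) :
    (boundedSizePartitionSystem n l u).B.mulVec y (Sum.inr (Sum.inl i)) = ∑ j, y (i, j) := by
  simp only [boundedSizePartitionSystem, Matrix.mulVec, dotProduct, Fintype.sum_prod_type,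
    Matrix.of_apply, Sum.elim_inl, Sum.elim_inr, ite_mul, one_mul, zero_mul]
  rw [Finset.sum_eq_single i (fun i' _ hi => by simp [hi]) (by simp)]
  simp

theorem boundedSizePartitionSystem_mulVec_B_inr_inr (y : Fin k × Fin n → ℝ)
    (c : Fin k × Fin n) :
    (boundedSizePartitionSystem n l u).B.mulVec y (Sum.inr (Sum.inr c)) = -y c := by
  simp [boundedSizePartitionSystem, Matrix.mulVec, dotProduct]

theorem boundedSizePartitionSystem_mulVec_A_eq_zero {y : Fin k × Fin n → ℝ} :
    (boundedSizePartitionSystem n l u).A.mulVec y = 0 ↔ ∀ j, ∑ i, y (i, j) = 0 := by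
  simp [funext_iff, boundedSizePartitionSystem_mulVec_A]

theorem mem_polyhedron_boundedSizePartitionSystem {y : Fin k × Fin n → ℝ} :
    y ∈ (boundedSizePartitionSystem n l u).polyhedron ↔
      (∀ j, ∑ i, y (i, j) = 1) ∧ (∀ i, (l i : ℝ) ≤ ∑ j, y (i, j)) ∧
      (∀ i, ∑ j, y (i, j) ≤ u i) ∧ ∀ c, 0 ≤ y c := by
  simp only [LinSystem.polyhedron, Set.mem_ofPred_eq, funext_iff, Pi.le_def, Sum.forall,
    boundedSizePartitionSystem_mulVec_A, boundedSizePartitionSystem_mulVec_B_inl,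
    boundedSizePartitionSystem_mulVec_B_inr_inl, boundedSizePartitionSystem_mulVec_B_inr_inr]
  simp [boundedSizePartitionSystem]

theorem boundedSizePartitionSystem_mulVec_B_eq_zero (x : Fin k × Fin n → ℝ)
    (hx : (boundedSizePartitionSystem n l u).B.mulVec x = 0) : x = 0 := by
  ext c
  simpa [boundedSizePartitionSystem_mulVec_B_inr_inr] using congrFun hx (Sum.inr (Sum.inr c))

/-- An integral column with sum 1 is a unit vector. A direction vanishing at its zeros vanishes at
the remaining cell too, because column sums are zero. -/
theorem boundedSizePartitionSystem_isVertex {y : Fin k × Fin n → ℝ}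
    (hy : y ∈ (boundedSizePartitionSystem n l u).polyhedron) (hint : IsIntegerVec y) :
    (boundedSizePartitionSystem n l u).IsVertex y := by
  classical
  obtain ⟨hc, -, -, h0⟩ := mem_polyhedron_boundedSizePartitionSystem.1 hy
  refine LinSystem.isVertex_of_tight hy fun h hA hB => ?_
  have hhc := boundedSizePartitionSystem_mulVec_A_eq_zero.1 hA
  have hz : ∀ c, y c = 0 → h c = 0 := fun c hc => by
    have := hB (Sum.inr (Sum.inr c)) (by
      rw [boundedSizePartitionSystem_mulVec_B_inr_inr, hc]; simp [boundedSizePartitionSystem])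
    simpa [boundedSizePartitionSystem_mulVec_B_inr_inr] using this
  ext ⟨i, j⟩
  by_cases hij : y (i, j) = 0
  · exact hz _ hij
  have hothers : ∀ i' ≠ i, h (i', j) = 0 := by
    intro i' hi'
    have hle : y (i, j) + y (i', j) ≤ 1 := by
      rw [← hc j, ← Finset.sum_pair (f := fun i => y (i, j)) hi'.symm]
      exact Finset.sum_le_sum_of_subset_of_nonneg (Finset.subset_univ _) fun i _ _ => h0 _
    have hpos := (h0 (i, j)).lt_of_ne' hij
    obtain ⟨z, hz'⟩ := hint (i, j)
    have h1 : 1 ≤ y (i, j) := by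
      rw [hz'] at hpos ⊢
      exact_mod_cast Int.add_one_le_iff.2 (by exact_mod_cast hpos : 0 < z)
    exact hz _ (le_antisymm (by linarith) (h0 _))
  exact (Finset.sum_eq_single i (fun i' _ hi' => hothers i' hi') (by simp)).symm.trans (hhc j)

/-- If the first row has integral sum, a fractional entry has a fractional partner and an exchange
keeps the tight rows. Otherwise no size bound is tight, and shifting a single fractional item is
possible. -/
theorem boundedSizePartitionSystem_two_isGCW (n : ℕ) (l u : Fin 2 → ℕ) :
    (boundedSizePartitionSystem n l u).IsGCW := by
  intro y hy
  obtain ⟨hc, hl, hu, h0⟩ := mem_polyhedron_boundedSizePartitionSystem.1 hy.1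
  have hone : ∀ j, y (1, j) = 1 - y (0, j) := fun j => by
    have := hc j
    rw [Fin.sum_univ_two] at this
    linarith
  have hsum : ∑ j, y (1, j) = n - ∑ j, y (0, j) := by simp [hone]
  suffices hrow : ∀ j, ∃ z : ℤ, y (0, j) = z by
    rintro ⟨i, j⟩
    obtain ⟨z, hz⟩ := hrow j
    fin_cases i
    · exact ⟨z, hz⟩
    · refine ⟨1 - z, ?_⟩
      simp only [Fin.mk_one]
      rw [hone, hz]
      push_cast
      rfl
  by_contra! hcon
  obtain ⟨j, hj⟩ := hcon
  have hne : ∀ j, (∀ z : ℤ, y (0, j) ≠ z) → ∀ i, y (i, j) ≠ 0 := by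
    intro j hj i hi
    fin_cases i
    · exact hj 0 (by simpa using hi)
    · simp only [Fin.mk_one] at hi
      rw [hone] at hi
      exact hj 1 (by push_cast; linarith)
  by_cases hs : ∃ z : ℤ, ∑ j, y (0, j) = z
  · obtain ⟨m, -, hmj, hm⟩ := exists_ne_not_int_of_sum_int hs (Finset.mem_univ j)
      (not_exists.2 hj)
    have := hy.eq_zero_of_tight (h := twoRow (unitDiff j m))
      (boundedSizePartitionSystem_mulVec_A_eq_zero.2 (twoRow_col _)) (by
        rintro (i | i | ⟨i, c⟩) hi
        · rw [boundedSizePartitionSystem_mulVec_B_inl, twoRow_row (sum_unitDiff j m), neg_zero]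
        · rw [boundedSizePartitionSystem_mulVec_B_inr_inl, twoRow_row (sum_unitDiff j m)]
        · rw [boundedSizePartitionSystem_mulVec_B_inr_inr] at hi ⊢
          have hic : y (i, c) = 0 := by simpa [boundedSizePartitionSystem] using hi
          have hcj : c ≠ j := by rintro rfl; exact hne _ hj i hic
          have hcm : c ≠ m := by rintro rfl; exact hne _ (not_exists.1 hm) i hic
          fin_cases i <;> simp [unitDiff_of_ne hcj hcm])
    exact twoRow_ne_zero (j := j) (by simp [unitDiff_left hmj.symm]) this
  · have hs' : ∀ (i : Fin 2) (N : ℕ), ∑ j, y (i, j) ≠ N := by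
      intro i N hN
      fin_cases i
      · exact hs ⟨N, by simpa using hN⟩
      · simp only [Fin.mk_one] at hN
        rw [hsum] at hN
        exact hs ⟨n - N, by push_cast; linarith⟩
    have := hy.eq_zero_of_tight (h := twoRow (Pi.single j 1))
      (boundedSizePartitionSystem_mulVec_A_eq_zero.2 (twoRow_col _)) (by
        rintro (i | i | ⟨i, c⟩) hi
        · rw [boundedSizePartitionSystem_mulVec_B_inl] at hi
          exact absurd (neg_injective hi) (hs' i (l i))
        · rw [boundedSizePartitionSystem_mulVec_B_inr_inl] at hi
          exact absurd hi (hs' i (u i))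
        · rw [boundedSizePartitionSystem_mulVec_B_inr_inr] at hi ⊢
          have hic : y (i, c) = 0 := by simpa [boundedSizePartitionSystem] using hi
          have hcj : c ≠ j := by rintro rfl; exact hne _ hj i hic
          fin_cases i <;> simp [hcj])
    exact twoRow_ne_zero (j := j) (by simp) this

/-- A circuit with zero row sums contains a swap. Otherwise the size rows are all in its support, so
it contains the move of one item. The row sum of `w` is recorded to bound the entries of `B` in the
size rows. -/
theorem boundedSizePartitionSystem_isCircuit_eq_smul {l u : Fin 2 → ℕ} {g : Fin 2 × Fin n → ℝ}
    (hg : (boundedSizePartitionSystem n l u).IsCircuit g) :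
    ∃ (c : ℝ) (w : Fin n → ℝ), g = c • twoRow w ∧
      (∀ j, w j = -1 ∨ w j = 0 ∨ w j = 1) ∧ (∑ j, w j = 0 ∨ ∑ j, w j = 1) := by
  have hc := boundedSizePartitionSystem_mulVec_A_eq_zero.1 hg.2.1
  have hrow : ∀ i, ∑ j, g (i, j) = 0 → ∑ j, g (0, j) = 0 := by
    intro i hi
    fin_cases i
    · exact hi
    · rw [eq_twoRow hc] at hi
      simpa using hi
  by_cases hs : ∑ j, g (0, j) = 0
  · obtain ⟨j, hj⟩ : ∃ j, g (0, j) ≠ 0 := by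
      by_contra! hcon
      refine hg.2.2.1 ?_
      rw [eq_twoRow hc]
      ext ⟨i, j⟩
      fin_cases i <;> simp [hcon]
    obtain ⟨m, hjm, hm⟩ := exists_ne_of_sum_eq_zero hs hj
    obtain ⟨c, hc⟩ := hg.eq_smul (h := twoRow (unitDiff j m))
      boundedSizePartitionSystem_mulVec_B_eq_zero
      (boundedSizePartitionSystem_mulVec_A_eq_zero.2 (twoRow_col _))
      (twoRow_ne_zero (j := j) (by simp [unitDiff_left hjm])) (by
        rintro (i | i | c) hi
        · rw [boundedSizePartitionSystem_mulVec_B_inl, twoRow_row (sum_unitDiff j m), neg_zero]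
        · rw [boundedSizePartitionSystem_mulVec_B_inr_inl, twoRow_row (sum_unitDiff j m)]
        · rw [boundedSizePartitionSystem_mulVec_B_inr_inr, neg_eq_zero] at hi ⊢
          exact twoRow_unitDiff_apply_eq_zero hc hj hm hi)
    exact ⟨c, _, hc, unitDiff_eq_or hjm, Or.inl (sum_unitDiff j m)⟩
  · obtain ⟨j, -, hj⟩ := Finset.exists_ne_zero_of_sum_ne_zero hs
    obtain ⟨c, hc⟩ := hg.eq_smul (h := twoRow (Pi.single j 1))
      boundedSizePartitionSystem_mulVec_B_eq_zero
      (boundedSizePartitionSystem_mulVec_A_eq_zero.2 (twoRow_col _))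
      (twoRow_ne_zero (j := j) (by simp)) (by
        rintro (i | i | ⟨i, m⟩) hi
        · rw [boundedSizePartitionSystem_mulVec_B_inl, neg_eq_zero] at hi
          exact absurd (hrow i hi) hs
        · rw [boundedSizePartitionSystem_mulVec_B_inr_inl] at hi
          exact absurd (hrow i hi) hs
        · rw [boundedSizePartitionSystem_mulVec_B_inr_inr, neg_eq_zero] at hi ⊢
          have hmj : m ≠ j := by
            rintro rfl
            rw [eq_twoRow hc] at hi
            fin_cases i <;> simp [hj] at hi
          fin_cases i <;> simp [hmj])
    refine ⟨c, _, hc, fun m => ?_, Or.inr (by simp)⟩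
    by_cases hmj : m = j <;> simp [hmj]

theorem boundedSizePartitionSystem_two_isVCW (n : ℕ) (l u : Fin 2 → ℕ) :
    (boundedSizePartitionSystem n l u).IsVCW := by
  have hGCW := boundedSizePartitionSystem_two_isGCW n l u
  refine ⟨hGCW, fun N y hy i => boundedSizePartitionSystem_isVertex (hy.mem i) <|
    hy.induction hGCW (fun x g a hx hxP hg ha hmem hmax => ?_) i⟩
  obtain ⟨c, w, hc, hw, hsw⟩ := boundedSizePartitionSystem_isCircuit_eq_smul hg
  have hwint : IsIntegerVec w := by
    intro j
    rcases hw j with h | h | h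
    · exact ⟨-1, by simp [h]⟩
    · exact ⟨0, by simp [h]⟩
    · exact ⟨1, by simp [h]⟩
  have hxr : ∀ i, ∃ z : ℤ, ∑ j, x (i, j) = z := by
    intro i
    choose z hz using hx
    exact ⟨∑ j, z (i, j), by simp [hz]⟩
  refine LinSystem.isIntegerVec_step (h := twoRow w) ?_ ?_ hx (isIntegerVec_twoRow hwint)
    (boundedSizePartitionSystem_mulVec_A_eq_zero.2 (twoRow_col _)) ?_ hxP hg.2.2.1 hc ha hmem hmax
  · rintro (i | i | c)
    · exact ⟨-l i, by simp [boundedSizePartitionSystem]⟩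
    · exact ⟨u i, by simp [boundedSizePartitionSystem]⟩
    · exact ⟨0, by simp [boundedSizePartitionSystem]⟩
  · rintro (i | i | c)
    · obtain ⟨z, hz⟩ := hxr i
      exact ⟨-z, by rw [boundedSizePartitionSystem_mulVec_B_inl, hz]; push_cast; rfl⟩
    · obtain ⟨z, hz⟩ := hxr i
      exact ⟨z, by rw [boundedSizePartitionSystem_mulVec_B_inr_inl, hz]⟩
    · obtain ⟨z, hz⟩ := hx c
      exact ⟨-z, by rw [boundedSizePartitionSystem_mulVec_B_inr_inr, hz]; push_cast; rfl⟩
  · rintro (i | i | c)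
    · rw [boundedSizePartitionSystem_mulVec_B_inl]
      fin_cases i <;> rcases hsw with h | h <;> simp [h]
    · rw [boundedSizePartitionSystem_mulVec_B_inr_inl]
      fin_cases i <;> rcases hsw with h | h <;> simp [h]
    · rw [boundedSizePartitionSystem_mulVec_B_inr_inr]
      exact twoRow_eq_or hw c

theorem boundedSizePartitionSystem_isCircuit_twoRow {l u : Fin 2 → ℕ} {j m : Fin n} (h : j ≠ m) :
    (boundedSizePartitionSystem n l u).IsCircuit (twoRow (unitDiff j m)) := by
  refine LinSystem.isCircuit_twoRow_unitDiff h
    (boundedSizePartitionSystem_mulVec_A_eq_zero.2 (twoRow_col _)) fun x hxA hxB =>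
    ⟨boundedSizePartitionSystem_mulVec_A_eq_zero.1 hxA, ?_, fun c hj hm => ?_⟩
  · have := hxB (Sum.inr (Sum.inl 0))
    rw [boundedSizePartitionSystem_mulVec_B_inr_inl, boundedSizePartitionSystem_mulVec_B_inr_inl]
      at this
    exact this (twoRow_row (sum_unitDiff j m) 0)
  · have := hxB (Sum.inr (Sum.inr (0, c)))
    simpa [boundedSizePartitionSystem_mulVec_B_inr_inr, unitDiff_of_ne hj hm] using this

end BoundedSize

/-- The swap from {0, 1} to {1, 2} is a diagonal of a square whose other diagonal joins {1} and {0,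
1, 2}, both of admissible size. The common midpoint contradicts extremality of an edge. -/
theorem not_isECW_boundedSizePartitionSystem :
    ¬ (boundedSizePartitionSystem 4 (fun _ : Fin 2 => 1) fun _ => 3).IsECW := by
  intro hE
  let vec : (Fin 4 → ℝ) → Fin 2 × Fin 4 → ℝ := fun w c => ![w c.2, 1 - w c.2] c.1
  have hvec : ∀ w : Fin 4 → ℝ, (∀ j, 0 ≤ w j ∧ w j ≤ 1) → 1 ≤ ∑ j, w j → ∑ j, w j ≤ 3 →
      vec w ∈ (boundedSizePartitionSystem 4 (fun _ : Fin 2 => 1) fun _ => 3).polyhedron := by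
    intro w hw h1 h3
    rw [mem_polyhedron_boundedSizePartitionSystem]
    refine ⟨fun j => by simp [vec], fun i => ?_, fun i => ?_, ?_⟩
    · fin_cases i <;> simp [vec] <;> linarith
    · fin_cases i <;> simp [vec] <;> linarith
    · rintro ⟨i, j⟩
      fin_cases i <;> simp [vec, hw j]
  have hvert : ∀ w : Fin 4 → ℝ, (∀ j, w j = 0 ∨ w j = 1) → 1 ≤ ∑ j, w j → ∑ j, w j ≤ 3 →
      (boundedSizePartitionSystem 4 (fun _ : Fin 2 => 1) fun _ => 3).IsVertex (vec w) := by
    intro w hw h1 h3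
    refine boundedSizePartitionSystem_isVertex (hvec w (fun j => ?_) h1 h3) ?_
    · rcases hw j with h | h <;> simp [h]
    · rintro ⟨i, j⟩
      fin_cases i <;> rcases hw j with h | h
      · exact ⟨0, by simp [vec, h]⟩
      · exact ⟨1, by simp [vec, h]⟩
      · exact ⟨1, by simp [vec, h]⟩
      · exact ⟨0, by simp [vec, h]⟩
  have hv₀ := hvert ![1, 1, 0, 0] (by simp [Fin.forall_fin_succ])
    (by norm_num [Fin.sum_univ_succ]) (by norm_num [Fin.sum_univ_succ])
  have hv₁ := hvert ![0, 1, 1, 0] (by simp [Fin.forall_fin_succ])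
    (by norm_num [Fin.sum_univ_succ]) (by norm_num [Fin.sum_univ_succ])
  have hm₀ := hvec ![0, 1, 0, 0] (by simp [Fin.forall_fin_succ])
    (by norm_num [Fin.sum_univ_succ]) (by norm_num [Fin.sum_univ_succ])
  have hm₁ := hvec ![1, 1, 1, 0] (by simp [Fin.forall_fin_succ])
    (by norm_num [Fin.sum_univ_succ]) (by norm_num [Fin.sum_univ_succ])
  have hwalk : (boundedSizePartitionSystem 4 (fun _ : Fin 2 => 1) fun _ => 3).IsCircuitWalk
      (k := 1) ![vec ![1, 1, 0, 0], vec ![0, 1, 1, 0]] := by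
    refine ⟨hv₀, hv₁, fun t => ?_⟩
    obtain rfl : t = 0 := Subsingleton.elim _ _
    refine ⟨hv₀.1, twoRow (unitDiff 2 0), 1,
      boundedSizePartitionSystem_isCircuit_twoRow (by decide), one_pos, ?_, fun a ha hcon => ?_⟩
    · ext ⟨i, j⟩
      fin_cases i <;> fin_cases j <;> simp [vec, unitDiff]
    · have := (mem_polyhedron_boundedSizePartitionSystem.1 hcon).2.2.2 (0, 0)
      simp [vec, unitDiff] at this
      linarith
  have hedge := (hE.2 1 _ hwalk 0).2.2.2
  have hmid : vec ![1 / 2, 1, 1 / 2, 0] ∈ segment ℝ (vec ![1, 1, 0, 0]) (vec ![0, 1, 1, 0]) := by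
    refine ⟨1 / 2, 1 / 2, by norm_num, by norm_num, by norm_num, ?_⟩
    ext ⟨i, j⟩
    fin_cases i <;> fin_cases j <;> simp [vec] <;> norm_num
  have hmid' : vec ![1 / 2, 1, 1 / 2, 0] ∈
      openSegment ℝ (vec ![0, 1, 0, 0]) (vec ![1, 1, 1, 0]) := by
    refine ⟨1 / 2, 1 / 2, by norm_num, by norm_num, by norm_num, ?_⟩
    ext ⟨i, j⟩
    fin_cases i <;> fin_cases j <;> simp [vec] <;> norm_num
  obtain ⟨α, β, -, -, hαβ, h⟩ := hedge.isExtreme.2 hm₀ hm₁ hmid hmid'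
  have h0 := congrFun h (0, 0)
  have h2 := congrFun h (0, 2)
  simp [vec] at h0 h2
  linarith

/-! ### A matroid polytope with a fractional circuit walk -/

/-- The matroid on three elements in which the last two are parallel and the first one is a
coloop. -/
def parallelColoopMatroid : Matroid (Fin 3) :=
  (Matroid.freeOn (Set.univ : Set (Fin 2))).comap ![0, 1, 1]

theorem parallelColoopMatroid_eRk (S : Finset (Fin 3)) :
    parallelColoopMatroid.eRk S = (S.image ![(0 : Fin 2), 1, 1]).card := by
  rw [parallelColoopMatroid, Matroid.eRk_comap, Matroid.eRk_freeOn (Set.subset_univ _),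
    ← Finset.coe_image, Set.encard_coe_eq_coe_finsetCard]

theorem parallelColoopMatroid_indep (I : Set (Fin 3)) :
    parallelColoopMatroid.Indep I ↔ ¬ (1 ∈ I ∧ 2 ∈ I) := by
  simp only [parallelColoopMatroid, Matroid.comap_indep_iff, Matroid.freeOn_indep_iff,
    Set.subset_univ, true_and]
  constructor
  · rintro h ⟨h1, h2⟩
    exact absurd (h h1 h2 rfl) (by decide)
  · intro h e he e' he' hee'
    fin_cases e <;> fin_cases e' <;> first | rfl | exact absurd hee' (by decide) | skip
    · exact absurd ⟨he, he'⟩ h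
    · exact absurd ⟨he', he⟩ h

theorem matroidSystem_mulVec_B_inl {n : ℕ} (M : Matroid (Fin n)) (x : Fin n → ℝ) (e : Fin n) :
    (matroidSystem M).B.mulVec x (Sum.inl e) = -x e := by
  simp [matroidSystem, Matrix.mulVec, dotProduct]

theorem matroidSystem_mulVec_B_inr {n : ℕ} (M : Matroid (Fin n)) (x : Fin n → ℝ)
    (S : Finset (Fin n)) : (matroidSystem M).B.mulVec x (Sum.inr S) = ∑ e ∈ S, x e := by
  simp [matroidSystem, Matrix.mulVec, dotProduct]

theorem parallelColoopMatroid_d_inr (S : Finset (Fin 3)) :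
    (matroidSystem parallelColoopMatroid).d (Sum.inr S) =
      (S.image ![(0 : Fin 2), 1, 1]).card := by
  simp [matroidSystem, parallelColoopMatroid_eRk]

/-- The rank of a set is the number of parallel classes it meets, so every rank inequality is a sum
of those of the classes, given nonnegativity. -/
theorem mem_polyhedron_parallelColoopMatroid {x : Fin 3 → ℝ} :
    x ∈ (matroidSystem parallelColoopMatroid).polyhedron ↔
      (∀ e, 0 ≤ x e) ∧ x 0 ≤ 1 ∧ x 1 + x 2 ≤ 1 := by
  have hpoly : x ∈ (matroidSystem parallelColoopMatroid).polyhedron ↔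
      (∀ e, 0 ≤ x e) ∧ ∀ S : Finset (Fin 3),
        ∑ e ∈ S, x e ≤ (S.image ![(0 : Fin 2), 1, 1]).card := by
    simp only [LinSystem.polyhedron, Set.mem_ofPred_eq, Pi.le_def, Sum.forall,
      matroidSystem_mulVec_B_inl, matroidSystem_mulVec_B_inr, parallelColoopMatroid_d_inr,
      eq_iff_true_of_subsingleton, true_and]
    simp [matroidSystem]
  rw [hpoly]
  refine and_congr_right fun h0 => ⟨fun h => ⟨?_, ?_⟩, fun ⟨h1, h2⟩ S => ?_⟩
  · simpa using h {0}
  · simpa using h {1, 2}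
  · rw [← Finset.sum_fiberwise_of_maps_to (t := S.image ![(0 : Fin 2), 1, 1])
      (fun e he => Finset.mem_image_of_mem _ he), ← nsmul_one]
    refine Finset.sum_le_card_nsmul _ _ _ fun c _ => ?_
    refine (Finset.sum_le_sum_of_subset_of_nonneg (Finset.filter_subset_filter _
      (Finset.subset_univ S)) fun e _ _ => h0 e).trans ?_
    rw [Finset.sum_filter]
    fin_cases c <;> simpa [Fin.sum_univ_succ]

theorem mem_indicators_parallelColoopMatroid {x : Fin 3 → ℝ} (hx : ∀ e, x e = 0 ∨ x e = 1)
    (h : x 1 = 0 ∨ x 2 = 0) :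
    ∃ I : Set (Fin 3), parallelColoopMatroid.Indep I ∧ x = I.indicator 1 := by
  classical
  refine ⟨{e | x e = 1}, (parallelColoopMatroid_indep _).2 ?_, ?_⟩
  · rintro ⟨h1, h2⟩
    simp only [Set.mem_ofPred_eq] at h1 h2
    rcases h with h | h <;> linarith
  · ext e
    rcases hx e with h | h <;> simp [h]

theorem polyhedron_parallelColoopMatroid :
    (matroidSystem parallelColoopMatroid).polyhedron = matroidPolytope parallelColoopMatroid := by
  classical
  refine Set.Subset.antisymm (fun x hx => ?_) (convexHull_min ?_ ?_)
  · obtain ⟨h0, h1, h2⟩ := mem_polyhedron_parallelColoopMatroid.1 hx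
    have hx0 := h0 0
    have hx1 := h0 1
    have hx2 := h0 2
    -- Products of the barycentric coordinates in the segment and in the triangle.
    let w : Fin 2 × Fin 3 → ℝ := fun c => ![1 - x 0, x 0] c.1 * ![1 - x 1 - x 2, x 1, x 2] c.2
    let v : Fin 2 × Fin 3 → Fin 3 → ℝ := fun c => ![![0, 1] c.1, ![0, 1, 0] c.2, ![0, 0, 1] c.2]
    have hxw : x = ∑ c, w c • v c := by
      ext e
      fin_cases e <;> simp [w, v, Fintype.sum_prod_type, Fin.sum_univ_succ] <;> ring
    rw [hxw]
    refine (convex_convexHull ℝ _).sum_mem (fun c _ => mul_nonneg ?_ ?_) ?_ fun c _ =>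
      subset_convexHull ℝ _ (mem_indicators_parallelColoopMatroid ?_ ?_)
    · obtain ⟨i, j⟩ := c
      fin_cases i <;> simp <;> linarith
    · obtain ⟨i, j⟩ := c
      fin_cases j <;> simp <;> linarith
    · simp [w, Fintype.sum_prod_type, Fin.sum_univ_succ]
      ring
    · obtain ⟨i, j⟩ := c
      fin_cases i <;> fin_cases j <;> simp [v, Fin.forall_fin_succ]
    · obtain ⟨i, j⟩ := c
      fin_cases j <;> simp [v]
  · rintro _ ⟨I, hI, rfl⟩
    rw [parallelColoopMatroid_indep] at hI
    refine mem_polyhedron_parallelColoopMatroid.2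
      ⟨fun e => Set.indicator_nonneg (fun _ _ => zero_le_one) e, ?_, ?_⟩
    · exact Set.indicator_le' (fun _ _ => le_rfl) (fun _ _ => zero_le_one) 0
    · by_cases h1 : (1 : Fin 3) ∈ I <;> by_cases h2 : (2 : Fin 3) ∈ I
      · exact absurd ⟨h1, h2⟩ hI
      all_goals simp [h1, h2]
  · intro x hx y hy a b ha hb hab
    rw [mem_polyhedron_parallelColoopMatroid] at hx hy ⊢
    obtain ⟨hx0, hx1, hx2⟩ := hx
    obtain ⟨hy0, hy1, hy2⟩ := hy
    simp only [Pi.add_apply, Pi.smul_apply, smul_eq_mul]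
    refine ⟨fun e => by have := hx0 e; have := hy0 e; positivity, ?_, ?_⟩ <;>
      nlinarith [mul_le_mul_of_nonneg_left hx1 ha, mul_le_mul_of_nonneg_left hy1 hb,
        mul_le_mul_of_nonneg_left hx2 ha, mul_le_mul_of_nonneg_left hy2 hb]

theorem isGCW_parallelColoopMatroid : (matroidSystem parallelColoopMatroid).IsGCW := by
  classical
  intro x hx
  rw [LinSystem.IsVertex, polyhedron_parallelColoopMatroid] at hx
  obtain ⟨I, -, rfl⟩ := extremePoints_convexHull_subset hx
  intro e
  by_cases he : e ∈ I
  · exact ⟨1, by simp [he]⟩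
  · exact ⟨0, by simp [he]⟩

theorem not_isICW_parallelColoopMatroid : ¬ (matroidSystem parallelColoopMatroid).IsICW := by
  intro hI
  have hmem := @mem_polyhedron_parallelColoopMatroid
  have hvert : ∀ x : Fin 3 → ℝ, x 0 = 1 → (x 1 = 0 ∨ x 1 = 1) → x 2 = 0 →
      (matroidSystem parallelColoopMatroid).IsVertex x := by
    intro x h0 h1 h2
    refine LinSystem.isVertex_of_tight (hmem.2 ⟨?_, h0.le, ?_⟩) fun h _ hB => ?_
    · rcases h1 with h1 | h1 <;> simp [Fin.forall_fin_succ, h0, h1, h2]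
    · rcases h1 with h1 | h1 <;> simp [h1, h2]
    · have hinl : ∀ e, x e = 0 → h e = 0 := fun e he => by
        have := hB (Sum.inl e) (by rw [matroidSystem_mulVec_B_inl, he]; simp [matroidSystem])
        simpa [matroidSystem_mulVec_B_inl] using this
      have hinr : ∀ e, x e = 1 → h e = 0 := fun e he => by
        have := hB (Sum.inr {e}) (by
          rw [matroidSystem_mulVec_B_inr, parallelColoopMatroid_d_inr]
          simp [he])
        simpa [matroidSystem_mulVec_B_inr] using this
      ext e
      fin_cases e
      · exact hinr 0 h0
      · exact h1.elim (hinl 1) (hinr 1)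
      · exact hinl 2 h2
  have hc₀ : (matroidSystem parallelColoopMatroid).IsCircuit ![-1, 1, 1] := by
    refine LinSystem.isCircuit_of_forall ![-1, 1, 1] (by simp [Fin.forall_fin_succ])
      (Finset.gcd_eq_one_of_apply_eq_one (Finset.mem_univ 1) rfl) (Subsingleton.elim _ _)
      (fun h => by simpa using congrFun h 1) fun x _ hx => ⟨x 1, ?_⟩
    -- The rank rows of {0, 1} and {0, 2}, though redundant for the polytope, vanish on (-1, 1, 1)
    -- and determine it up to scaling; they are what makes it a circuit.
    have h1 := hx (Sum.inr {0, 1}) (by simp [matroidSystem_mulVec_B_inr])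
    have h2 := hx (Sum.inr {0, 2}) (by simp [matroidSystem_mulVec_B_inr])
    simp [matroidSystem_mulVec_B_inr] at h1 h2
    ext e
    fin_cases e <;> simp <;> linarith
  have hc₁ : (matroidSystem parallelColoopMatroid).IsCircuit ![1, 1, -1] := by
    refine LinSystem.isCircuit_of_forall ![1, 1, -1] (by simp [Fin.forall_fin_succ])
      (Finset.gcd_eq_one_of_apply_eq_one (Finset.mem_univ 1) rfl) (Subsingleton.elim _ _)
      (fun h => by simpa using congrFun h 1) fun x _ hx => ⟨x 1, ?_⟩
    have h1 := hx (Sum.inr {0, 2}) (by simp [matroidSystem_mulVec_B_inr])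
    have h2 := hx (Sum.inr {1, 2}) (by simp [matroidSystem_mulVec_B_inr])
    simp [matroidSystem_mulVec_B_inr] at h1 h2
    ext e
    fin_cases e <;> simp <;> linarith
  let y : Fin 3 → Fin 3 → ℝ := ![![1, 0, 0], ![1 / 2, 1 / 2, 1 / 2], ![1, 1, 0]]
  have hwalk : (matroidSystem parallelColoopMatroid).IsCircuitWalk (k := 2) y := by
    have hv₀ := hvert ![1, 0, 0] (by simp) (by simp) (by simp)
    refine ⟨hv₀, hvert ![1, 1, 0] (by simp) (by simp) (by simp), fun t => ?_⟩
    fin_cases t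
    · refine ⟨hv₀.1, ![-1, 1, 1], 1 / 2, hc₀, by norm_num, ?_, fun a ha hcon => ?_⟩
      · ext e
        fin_cases e <;> simp [y] <;> norm_num
      · have := (hmem.1 hcon).2.2
        simp [y] at this
        linarith
    · refine ⟨hmem.2 ?_, ![1, 1, -1], 1 / 2, hc₁, by norm_num, ?_, fun a ha hcon => ?_⟩
      · simp [y, Fin.forall_fin_succ]
        norm_num
      · ext e
        fin_cases e <;> simp [y] <;> norm_num
      · have := (hmem.1 hcon).1 2
        simp [y] at this
        linarith
  obtain ⟨z, hz⟩ := hI.2 2 y hwalk 1 0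
  have h2 : ((2 * z : ℤ) : ℝ) = (1 : ℤ) := by
    push_cast
    rw [← hz]
    simp [y]
  have := Int.cast_injective h2
  omega

theorem theorem4 :
    (∃ (n : ℕ) (M : Matroid (Fin n)), M.E = Set.univ ∧
      (matroidSystem M).polyhedron = matroidPolytope M ∧
      (matroidSystem M).IsGCW ∧ ¬ (matroidSystem M).IsICW) ∧
    (∃ (m n : ℕ) (u : Fin m → ℕ) (v : Fin n → ℕ), (∀ i, 0 < u i) ∧ (∀ j, 0 < v j) ∧
      (transportationSystem u v).IsICW ∧ ¬ (transportationSystem u v).IsVCW) ∧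
    (∃ (k n : ℕ) (l u : Fin k → ℕ), (∀ i, 0 < l i) ∧ (∀ i, l i ≤ u i) ∧
      (boundedSizePartitionSystem n l u).IsVCW ∧ ¬ (boundedSizePartitionSystem n l u).IsECW) ∧
    (∀ (k n : ℕ) (κ : Fin k → ℕ), (fixedSizePartitionSystem n κ).IsECW) := by
  refine ⟨⟨3, parallelColoopMatroid, rfl, polyhedron_parallelColoopMatroid,
    isGCW_parallelColoopMatroid, not_isICW_parallelColoopMatroid⟩,
    ⟨2, 3, ![3, 2], ![1, 2, 2], by simp [Fin.forall_fin_succ], by simp [Fin.forall_fin_succ],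
      transportationSystem_two_isICW _ _, not_isVCW_transportationSystem⟩,
    ⟨2, 4, fun _ => 1, fun _ => 3, fun _ => one_pos, fun _ => by norm_num,
      boundedSizePartitionSystem_two_isVCW _ _ _, not_isECW_boundedSizePartitionSystem⟩,
    fixedSizePartitionSystem_isECW⟩
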